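/- A \emph{skew brace} is a set $B$ with two group structures $(B,+)$ and $(B,\cdot)$ such that $a(b+c)=ab-a+ac$ for all $a,b,c\in B$; both groups have the same identity, written $0$. Put $\lambda_a(b)=-a+ab$ and $\rho_b(a)=\lambda_a(b)^{-1}ab$. An \emph{ideal} of $B$ is a subgroup of $(B,+)$ that is invariant under all $\lambda_a$ and normal in both $(B,+)$ and $(B,\cdot)$. A skew brace is \emph{abelian} if $a+b=ab=b+a$ for all $a,b$; an ideal is \emph{abelian} if it is an abelian skew brace. $B$ is \emph{soluble} if there are ideals $0=I_t\subseteq\dots\subseteq I_1\subseteq I_0=B$ of $B$ such that every $I_{k-1}/I_k$ is abelian. A \emph{solution} $(X,r)$ is a bijective non-degenerate set-theoretic solution of the Yang--Baxter equation: $r(x,y)=(\lambda_x(y),\rho_y(x))$ with $r$, all $\lambda_x$ and all $\rho_y$ bijective, and $(r\times\mathrm{id})(\mathrm{id}\times r)(r\times\mathrm{id})=(\mathrm{id}\times r)(r\times\mathrm{id})(\mathrm{id}\times r)$. A skew brace $B$ has the \emph{associated solution} $(B,r_B)$, $r_B(a,b)=(\lambda_a(b),\rho_b(a))$. A \emph{homomorphism}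 of solutions $f:(X,r)\to(Y,s)$ is a map with $(f\times f)r=s(f\times f)$, an \emph{epimorphism} if it is surjective; $\ker f$ denotes the equivalence relation $f(x)=f(y)$. It is an \emph{i-homomorphism} with \emph{i-kernel} $X_0$ if $X_0$ is a class of $\ker f$ such that $r(X_0\times Z)=Z\times X_0$ and $r(Z\times X_0)=X_0\times Z$ for every class $Z$ of $\ker f$; an \emph{i-epimorphism} is a surjective i-homomorphism. The \emph{structure skew brace} $G_X$ of $(X,r)$ has multiplicative group $\langle X\mid xy=\lambda_x(y)\rho_y(x)\ (x,y\in X)\rangle$ and additive group $\langle X\mid x+\lambda_x(y)=\lambda_x(y)+\lambda_{\lambda_x(y)}(\rho_y(x))\ (x,y\in X)\rangle$, the two being identified by the bijective $1$-cocycle that is the identity on the generators; let $\iota:X\to G_X$ be the canonical map. The \emph{permutation skew brace} $\mathcal G(X,r)$ is the subgroup $\langle(\lambda_x,\rho_x^{-1})\mid x\in X\rangle$ of $\mathrm{Sym}_X\times\mathrm{Sym}_X$ with the sum that makes the group epimorphism $G_X\to\mathcal G(X,r)$, $\iota(x)\mapsto(\lambda_x,\rho_x^{-1})$, a homomorphism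 of skew braces. The solution $(X,r)$ is \emph{soluble} if there are skew braces $B_0,\dots,B_t$, i-epimorphisms of solutions $f_k:X\to B_k$ with i-kernels $X_k\subseteq X$ for $0\le k\le t-1$, and an epimorphism of solutions $f_t:X\to B_t$ (each $B_k$ with its associated solution) such that $\ker f_0$ has the single class $X$, $\ker f_t\subseteq\ker\iota$, and for every $1\le k\le t$: $\ker f_k\subseteq\ker f_{k-1}$, and $f_k(X_{k-1})$ is contained in an abelian ideal $J$ of $B_k$ with $f_k(x)J=f_k(y)J$ for all $x,y\in X$ with $f_{k-1}(x)=f_{k-1}(y)$. \textbf{Statement.} For every skew brace $B$ the following are equivalent: (1) $B$ is a soluble skew brace; (2) the associated solution $(B,r_B)$ is soluble; (3) the structure skew brace $G_B$ of $(B,r_B)$ is soluble; (4) the permutation skew brace $\mathcal G(B,r_B)$ is soluble. -/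

import Mathlib

universe u v

/-! ## Skew braces -/

/-- A skew (left) brace: two group structures `(B, +)` and `(B, *)` on the same set, neither assumed
commutative, with `a * (b + c) = a * b - a + a * c`. -/
class SkewBrace (B : Type u) extends AddGroup B, Group B where
  mul_add_eq : ∀ a b c : B, a * (b + c) = a * b - a + a * c

namespace SkewBrace

variable {B : Type u} [SkewBrace B]

/-- The left action `λ_a(b) = -a + a b`. -/
def lam (a b : B) : B := -a + a * b

/-- The right action `ρ_b(a) = λ_a(b)⁻¹ a b`. -/
def rho (b a : B) : B := (lam a b)⁻¹ * a * b

theorem one_eq_zero : (1 : B) = 0 := by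
  have h := mul_add_eq (1 : B) 0 0
  simpa using h

theorem mul_zero_eq (a : B) : a * 0 = a := by rw [← one_eq_zero, mul_one]

theorem add_lam (a b : B) : a + lam a b = a * b := by simp [lam]

theorem lam_mul_rho (a b : B) : lam a b * rho b a = a * b := by simp [rho, mul_assoc]

theorem lam_add (a b c : B) : lam a (b + c) = lam a b + lam a c := by
  simp [lam, mul_add_eq, sub_eq_add_neg, add_assoc]

theorem mul_lam (a b c : B) : lam (a * b) c = lam a (lam b c) := by
  have h1 : a * b + lam (a * b) c = a * b + lam a (lam b c) := by
    have h2 : lam a (b * c) = lam a b + lam a (lam b c) := by rw [← add_lam b c, lam_add]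
    rw [add_lam, ← add_lam a b, add_assoc, ← h2, add_lam, add_lam, mul_assoc]
  exact add_left_cancel h1

theorem one_lam (b : B) : lam 1 b = b := by
  rw [lam, one_mul, one_eq_zero, neg_zero, zero_add]

theorem lam_zero (a : B) : lam a 0 = 0 := by simp [lam, mul_zero_eq]

theorem lam_inv_lam (a b : B) : lam a⁻¹ (lam a b) = b := by
  rw [← mul_lam, inv_mul_cancel, one_lam]

theorem lam_lam_inv (a b : B) : lam a (lam a⁻¹ b) = b := by
  rw [← mul_lam, mul_inv_cancel, one_lam]

theorem lam_neg (a b : B) : lam a (-b) = -lam a b := by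
  rw [eq_neg_iff_add_eq_zero, ← lam_add, neg_add_cancel, lam_zero]

/-- `λ_a(b) = a (a⁻¹ + b)`. -/
theorem lam_eq_mul (a b : B) : lam a b = a * (a⁻¹ + b) := by
  rw [mul_add_eq, mul_inv_cancel, one_eq_zero, zero_sub, lam]

/-- `ρ_b(a) = (a⁻¹ + b)⁻¹ b`. -/
theorem rho_eq (b a : B) : rho b a = (a⁻¹ + b)⁻¹ * b := by
  rw [rho, lam_eq_mul]; group

theorem rho_mul (a b c : B) : rho (b * c) a = rho c (rho b a) := by
  have h : (a⁻¹ + b * c) = b * (b⁻¹ * (a⁻¹ + b) + c) := by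
    rw [mul_add_eq, mul_inv_cancel_left, add_sub_cancel_right]
  rw [rho_eq, rho_eq, rho_eq, h]
  group

theorem rho_one (a : B) : rho 1 a = a := by
  rw [rho_eq, one_eq_zero, add_zero, ← one_eq_zero, inv_inv, mul_one]

/-- The matched pair identity `λ_a(b c) = λ_a(b) λ_{ρ_b(a)}(c)`. -/
theorem lam_mul (a b c : B) : lam a (b * c) = lam a b * lam (rho b a) c := by
  have h : lam a b + lam (lam a b) (lam (rho b a) c) = lam a (b * c) := by
    rw [← mul_lam, lam_mul_rho, mul_lam, ← lam_add, add_lam]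
  rw [← h, add_lam]

variable (B) in
/-- An ideal of a skew brace: a subgroup of `(B, +)` which is `λ`-invariant and normal in both
`(B, +)` and `(B, *)`. -/
structure SkewIdeal extends AddSubgroup B where
  lam_mem' : ∀ a b : B, b ∈ carrier → lam a b ∈ carrier
  add_conj_mem' : ∀ a b : B, b ∈ carrier → a + b - a ∈ carrier
  mul_conj_mem' : ∀ a b : B, b ∈ carrier → a * b * a⁻¹ ∈ carrier

namespace SkewIdeal

instance : SetLike (SkewIdeal B) B where
  coe I := I.carrier
  coe_injective := by
    rintro ⟨I, _, _, _⟩ ⟨J, _, _, _⟩ h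
    have : I = J := SetLike.coe_injective h
    subst this
    rfl

variable (I : SkewIdeal B)

theorem lam_mem (a : B) {b : B} (hb : b ∈ I) : lam a b ∈ I := I.lam_mem' a b hb

theorem add_mem {a b : B} (ha : a ∈ I) (hb : b ∈ I) : a + b ∈ I := I.toAddSubgroup.add_mem ha hb

theorem neg_mem {a : B} (ha : a ∈ I) : -a ∈ I := I.toAddSubgroup.neg_mem ha

theorem zero_mem : (0 : B) ∈ I := I.toAddSubgroup.zero_mem

theorem mul_mem {a b : B} (ha : a ∈ I) (hb : b ∈ I) : a * b ∈ I := by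
  rw [← add_lam]; exact I.add_mem ha (I.lam_mem a hb)

theorem inv_mem {a : B} (ha : a ∈ I) : a⁻¹ ∈ I := by
  have h : lam a⁻¹ (-a) = a⁻¹ := by
    rw [lam_neg, lam, inv_mul_cancel, one_eq_zero, add_zero, neg_neg]
  rw [← h]; exact I.lam_mem _ (I.neg_mem ha)

/-- An ideal as a subgroup of the multiplicative group. -/
def toSubgroup : Subgroup B where
  carrier := I
  mul_mem' := I.mul_mem
  one_mem' := by rw [one_eq_zero]; exact I.zero_mem
  inv_mem' := I.inv_mem

theorem mem_toSubgroup {a : B} : a ∈ I.toSubgroup ↔ a ∈ I := Iff.rfl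

instance : I.toSubgroup.Normal := ⟨fun b hb a => I.mul_conj_mem' a b hb⟩

end SkewIdeal

theorem map_eq_iff {H : Type v} [Group H] (h : B →* H) (I : SkewIdeal B)
    (hI : ∀ a, h a = 1 ↔ a ∈ I) (a b : B) : h a = h b ↔ -a + b ∈ I := by
  have h1 : -a + b = lam a (a⁻¹ * b) := by rw [lam, mul_inv_cancel_left]
  have h2 : a⁻¹ * b = lam a⁻¹ (-a + b) := by rw [h1, lam_inv_lam]
  rw [← inv_mul_eq_one, ← map_inv, ← map_mul, hI]
  exact ⟨fun h => h1 ▸ I.lam_mem a h, fun h => h2 ▸ I.lam_mem _ h⟩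

theorem map_add_congr {H : Type v} [Group H] (h : B →* H) (I : SkewIdeal B)
    (hI : ∀ a, h a = 1 ↔ a ∈ I) {a b a' b' : B} (ha : h a = h a') (hb : h b = h b') :
    h (a + b) = h (a' + b') := by
  rw [map_eq_iff h I hI] at ha hb ⊢
  have e : -(a + b) + (a' + b') = (-b + (-a + a') - -b) + (-b + b') := by
    simp [sub_eq_add_neg, add_assoc]
  rw [e]
  exact I.add_mem (I.add_conj_mem' _ _ ha) hb

/-- If `h : (B, *) → H` is a surjective group homomorphism whose kernel is an ideal of `B`, then `H`
is a skew brace with the sum given by `h a + h b = h (a + b)`. -/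
noncomputable abbrev ofSurjective {H : Type v} [Group H] (h : B →* H)
    (hs : Function.Surjective h) (I : SkewIdeal B) (hI : ∀ a, h a = 1 ↔ a ∈ I) : SkewBrace H :=
  have key := map_eq_iff h I hI
  have hadd : ∀ a b a' b', h a = h a' → h b = h b' → h (a + b) = h (a' + b') :=
    fun _ _ _ _ => map_add_congr h I hI
  have hsec : ∀ x, h (Function.surjInv hs x) = x := Function.surjInv_eq hs
  letI : Add H := ⟨fun x y => h (Function.surjInv hs x + Function.surjInv hs y)⟩
  letI : Zero H := ⟨h 0⟩
  letI : Neg H := ⟨fun x => h (-Function.surjInv hs x)⟩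
  have map_add : ∀ a b, h (a + b) = h a + h b := fun a b =>
    hadd _ _ _ _ (hsec _).symm (hsec _).symm
  { toGroup := inferInstance
    toAddGroup := AddGroup.ofLeftAxioms
      (by
        intro x y z
        rw [← hsec x, ← hsec y, ← hsec z, ← map_add, ← map_add, ← map_add, ← map_add, add_assoc])
      (by
        intro x
        change h 0 + x = x
        rw [← hsec x, ← map_add, zero_add])
      (by
        intro x
        change h (-Function.surjInv hs x) + x = h 0
        have := map_add (-Function.surjInv hs x) (Function.surjInv hs x)
        rw [hsec x, neg_add_cancel] at this
        exact this.symm)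
    mul_add_eq := by
      intro x y z
      have hneg : ∀ a, h (-a) = - h a := fun a => by
        change h (-a) = h (-Function.surjInv hs (h a))
        rw [key, neg_neg]
        have h4 : h a = h (Function.surjInv hs (h a)) := (hsec _).symm
        rw [key] at h4
        have h5 := I.add_conj_mem' a _ (I.neg_mem h4)
        have h6 : a + -(-a + Function.surjInv hs (h a)) - a = a + -Function.surjInv hs (h a) := by
          simp [sub_eq_add_neg, add_assoc]
        rw [h6] at h5
        exact h5
      change x * (y + z) = x * y + - x + x * z
      rw [← hsec x, ← hsec y, ← hsec z, ← map_add, ← map_mul, mul_add_eq, sub_eq_add_neg,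
        map_add, map_add, map_mul, map_mul, hneg] }

theorem ofSurjective_map_add {H : Type v} [Group H] (h : B →* H)
    (hs : Function.Surjective h) (I : SkewIdeal B) (hI : ∀ a, h a = 1 ↔ a ∈ I) (a b : B) :
    letI := ofSurjective h hs I hI
    h (a + b) = h a + h b :=
  map_add_congr h I hI (Function.surjInv_eq hs _).symm (Function.surjInv_eq hs _).symm

namespace SkewIdeal

variable (I : SkewIdeal B)

/-- The quotient skew brace `B / I`. -/
def Quotient : Type u := B ⧸ I.toSubgroup

/-- The canonical map `B → B / I`. -/
def proj (a : B) : I.Quotient := QuotientGroup.mk' I.toSubgroup a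

noncomputable instance : SkewBrace I.Quotient :=
  ofSurjective (H := B ⧸ I.toSubgroup) (QuotientGroup.mk' I.toSubgroup)
    (QuotientGroup.mk'_surjective _) I
    (fun a => QuotientGroup.eq_one_iff a)

theorem proj_surjective : Function.Surjective I.proj := QuotientGroup.mk'_surjective _

theorem proj_mul (a b : B) : I.proj (a * b) = I.proj a * I.proj b := rfl

theorem proj_add (a b : B) : I.proj (a + b) = I.proj a + I.proj b :=
  ofSurjective_map_add (QuotientGroup.mk' I.toSubgroup) (QuotientGroup.mk'_surjective _) I
    (fun a => QuotientGroup.eq_one_iff a) a b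

theorem proj_eq_proj {a b : B} : I.proj a = I.proj b ↔ a⁻¹ * b ∈ I := QuotientGroup.eq

end SkewIdeal

/-- A subset of a skew brace is abelian if on it both operations coincide and are commutative.
A subbrace is abelian as a skew brace iff its underlying set is. -/
def IsAbelianSet (S : Set B) : Prop := ∀ a ∈ S, ∀ b ∈ S, a + b = a * b ∧ a + b = b + a

variable (B) in
/-- A skew brace `B` is soluble if there is a chain of ideals `0 = I_t ≤ ... ≤ I_1 ≤ I_0 = B` of `B`
such that each factor `I_k / I_(k+1)`, a subbrace of `B / I_(k+1)`, is an abelian skew brace. -/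
def IsSoluble : Prop :=
  ∃ (t : ℕ) (I : ℕ → SkewIdeal B),
    (I 0 : Set B) = Set.univ ∧ (I t : Set B) = {0} ∧
    ∀ k < t, (I (k + 1) : Set B) ⊆ I k ∧ IsAbelianSet ((I (k + 1)).proj '' (I k : Set B))

end SkewBrace

/-! ## Solutions of the Yang-Baxter equation -/

/-- The map `r × id` on `X × X × X`. -/
def onFirstTwo {X : Type u} (r : X × X → X × X) : X × X × X → X × X × X :=
  fun p => ((r (p.1, p.2.1)).1, (r (p.1, p.2.1)).2, p.2.2)

/-- The map `id × r` on `X × X × X`. -/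
def onLastTwo {X : Type u} (r : X × X → X × X) : X × X × X → X × X × X := Prod.map id r

/-- A (bijective, non-degenerate, set-theoretic) solution of the Yang-Baxter equation on `X`:
`r (x, y) = (λ_x(y), ρ_y(x))` with all the maps `λ_x` and `ρ_y` bijective. -/
structure YBESolution (X : Type u) where
  r : X × X → X × X
  bijective : Function.Bijective r
  braid : onFirstTwo r ∘ onLastTwo r ∘ onFirstTwo r = onLastTwo r ∘ onFirstTwo r ∘ onLastTwo r
  lam_bijective : ∀ x, Function.Bijective fun y => (r (x, y)).1
  rho_bijective : ∀ y, Function.Bijective fun x => (r (x, y)).2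

namespace YBESolution

variable {X : Type u} (S : YBESolution X)

/-- The permutation `λ_x` of `X`. -/
noncomputable def lam (x : X) : Equiv.Perm X := Equiv.ofBijective _ (S.lam_bijective x)

/-- The permutation `ρ_y` of `X`. -/
noncomputable def rho (y : X) : Equiv.Perm X := Equiv.ofBijective _ (S.rho_bijective y)

theorem r_eq (x y : X) : S.r (x, y) = (S.lam x y, S.rho y x) := rfl

theorem braid_apply (x y z : X) :
    S.lam (S.lam x y) (S.lam (S.rho y x) z) = S.lam x (S.lam y z) ∧
    S.rho (S.lam (S.rho y x) z) (S.lam x y) = S.lam (S.rho (S.lam y z) x) (S.rho z y) ∧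
    S.rho z (S.rho y x) = S.rho (S.rho z y) (S.rho (S.lam y z) x) := by
  have h := congrFun S.braid (x, y, z)
  simp only [onFirstTwo, onLastTwo, Function.comp_apply, Prod.map, id, r_eq, Prod.mk.injEq] at h
  exact h

theorem lam_mul_lam (x y : X) : S.lam x * S.lam y = S.lam (S.lam x y) * S.lam (S.rho y x) :=
  Equiv.ext fun z => (S.braid_apply x y z).1.symm

theorem rho_mul_rho (y z : X) : S.rho z * S.rho y = S.rho (S.rho z y) * S.rho (S.lam y z) :=
  Equiv.ext fun x => (S.braid_apply x y z).2.2

theorem onFirstTwo_injective : Function.Injective (onFirstTwo S.r) := by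
  rintro ⟨a, b, c⟩ ⟨a', b', c'⟩ h
  simp only [onFirstTwo, Prod.mk.injEq] at h
  obtain ⟨h1, h2, rfl⟩ := h
  have h3 := S.bijective.1 (Prod.ext h1 h2)
  simp only [Prod.mk.injEq] at h3
  rw [h3.1, h3.2]

theorem onLastTwo_injective : Function.Injective (onLastTwo S.r) :=
  Function.Injective.prodMap Function.injective_id S.bijective.1

/-- The map `y ↦ λ_y⁻¹(y)` is bijective. -/
theorem diag_bijective : Function.Bijective fun y => (S.lam y)⁻¹ y := by
  have hsurj : ∀ z, ∃ u, S.lam u z = u ∧ ∃ x, S.r (x, z) = (u, z) := by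
    intro y
    obtain ⟨x, hx⟩ := (S.rho y).surjective y
    refine ⟨S.lam x y, ?_, x, by rw [r_eq, hx]⟩
    have h := S.lam_mul_lam x y
    rw [hx, mul_left_inj] at h
    exact (congrArg (fun σ => σ y) h).symm
  have huniq : ∀ z y, S.lam y z = y → ∃ x, S.r (x, z) = (y, z) := by
    intro z y hy
    obtain ⟨s, hs⟩ := (S.rho y).surjective y
    obtain ⟨⟨a, b⟩, hab⟩ := S.bijective.2 (s, y)
    obtain ⟨⟨y', z'⟩, hyz⟩ := S.bijective.2 (y, z)
    have h1 : (onFirstTwo S.r ∘ onLastTwo S.r ∘ onFirstTwo S.r) (a, b, z) =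
        (onFirstTwo S.r ∘ onLastTwo S.r ∘ onFirstTwo S.r) (s, y', z') := by
      conv_rhs => rw [S.braid]
      simp only [onFirstTwo, onLastTwo, Function.comp_apply, Prod.map, id, hab, hyz]
      simp only [r_eq, hy, hs]
    have h2 := S.onFirstTwo_injective (S.onLastTwo_injective (S.onFirstTwo_injective h1))
    simp only [Prod.mk.injEq] at h2
    exact ⟨y', by rw [hyz.symm, h2.2.2]⟩
  constructor
  · intro y u h
    have hy : S.lam y ((S.lam y)⁻¹ y) = y := (S.lam y).apply_symm_apply y
    have hu : S.lam u ((S.lam y)⁻¹ y) = u := by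
      have h' : (S.lam y)⁻¹ y = (S.lam u)⁻¹ u := h
      rw [h']
      exact (S.lam u).apply_symm_apply u
    obtain ⟨p, hp⟩ := huniq _ _ hy
    obtain ⟨q, hq⟩ := huniq _ _ hu
    rw [r_eq, Prod.mk.injEq] at hp hq
    have hpq : p = q := (S.rho _).injective (hp.2.trans hq.2.symm)
    rw [← hp.1, ← hq.1, hpq]
  · intro z
    obtain ⟨u, hu, -⟩ := hsurj z
    exact ⟨u, by simpa using ((S.lam u).symm_apply_eq.2 hu.symm)⟩

/-! ### The structure skew brace -/

/-- The relators `x y (λ_x(y) ρ_y(x))⁻¹` of the structure group. -/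
def structureRels : Set (FreeGroup X) :=
  Set.range fun p : X × X => FreeGroup.of p.1 * FreeGroup.of p.2 *
    (FreeGroup.of (S.lam p.1 p.2) * FreeGroup.of (S.rho p.2 p.1))⁻¹

/-- The structure group `G(X, r) = ⟨X ∣ x y = λ_x(y) ρ_y(x)⟩`. -/
abbrev StructureGroup : Type u := PresentedGroup S.structureRels

/-- The canonical map `ι : X → G(X, r)`, not injective in general. -/
def incl (x : X) : S.StructureGroup := PresentedGroup.of x

theorem incl_mul_incl (x y : X) :
    S.incl x * S.incl y = S.incl (S.lam x y) * S.incl (S.rho y x) := by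
  have h : PresentedGroup.mk S.structureRels _ = 1 := PresentedGroup.one_of_mem ⟨(x, y), rfl⟩
  rw [map_mul, map_inv, mul_inv_eq_one] at h
  exact h

@[elab_as_elim]
theorem structure_induction {p : S.StructureGroup → Prop} (hof : ∀ x, p (S.incl x)) (h1 : p 1)
    (hmul : ∀ g h, p g → p h → p (g * h)) (hinv : ∀ g, p g → p g⁻¹) (g : S.StructureGroup) :
    p g :=
  PresentedGroup.generated_by _
    { carrier := {g | p g}, mul_mem' := fun {a b} ha hb => hmul a b ha hb, one_mem' := h1,
      inv_mem' := fun {a} ha => hinv a ha } hof g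

/-- The homomorphism from the structure group extending a map on `X` compatible with `r`. -/
def structureLift {H : Type v} [Group H] (f : X → H)
    (hf : ∀ x y, f x * f y = f (S.lam x y) * f (S.rho y x)) : S.StructureGroup →* H :=
  PresentedGroup.toGroup (f := f) (by
    rintro _ ⟨⟨x, y⟩, rfl⟩
    simp only [map_mul, map_inv, FreeGroup.lift_apply_of]
    rw [mul_inv_eq_one]
    exact hf x y)

theorem structureLift_incl {H : Type v} [Group H] (f : X → H)
    (hf : ∀ x y, f x * f y = f (S.lam x y) * f (S.rho y x)) (x : X) :
    S.structureLift f hf (S.incl x) = f x := PresentedGroup.toGroup.of _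

/-- The action `λ` of the structure group on `X`. -/
noncomputable def lamHom : S.StructureGroup →* Equiv.Perm X :=
  S.structureLift S.lam S.lam_mul_lam

theorem lamHom_incl (x : X) : S.lamHom (S.incl x) = S.lam x := S.structureLift_incl _ _ x

/-- The homomorphism `x ↦ ρ_x⁻¹` on the structure group. -/
noncomputable def rhoInvHom : S.StructureGroup →* Equiv.Perm X :=
  S.structureLift (fun x => (S.rho x)⁻¹) fun x y => by
    rw [← mul_inv_rev, ← mul_inv_rev, S.rho_mul_rho]

theorem rhoInvHom_incl (x : X) : S.rhoInvHom (S.incl x) = (S.rho x)⁻¹ :=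
  S.structureLift_incl _ _ x

/-- `derived q p = λ_q(ρ_y(p))`, where `λ_p(y) = q`. -/
noncomputable def derived (q p : X) : X := S.lam q (S.rho ((S.lam p)⁻¹ q) p)

theorem derived_lam (x y : X) : S.derived (S.lam x y) x = S.lam (S.lam x y) (S.rho y x) := by
  simp [derived]

theorem lam_derived (x q p : X) :
    S.lam x (S.derived q p) = S.derived (S.lam x q) (S.lam x p) := by
  obtain ⟨y, rfl⟩ := (S.lam p).surjective q
  have h1 := S.braid_apply x p y
  rw [derived_lam, ← h1.1, derived_lam, h1.2.1]
  have h2 := S.braid_apply x (S.lam p y) (S.rho y p)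
  rw [← h2.1, h1.1]

theorem lamHom_derived (g : S.StructureGroup) :
    ∀ q p, S.lamHom g (S.derived q p) = S.derived (S.lamHom g q) (S.lamHom g p) := by
  refine S.structure_induction ?_ ?_ ?_ ?_ g
  · intro x q p
    rw [lamHom_incl, lam_derived]
  · intro q p
    simp
  · intro g h hg hh q p
    rw [map_mul, Equiv.Perm.mul_apply, hh, hg]
    rfl
  · intro g hg q p
    rw [map_inv, Equiv.Perm.inv_eq_iff_eq, hg]
    simp

/-- The relators `x + λ_x(y) - (λ_x(y) + λ_{λ_x(y)}(ρ_y(x)))`, in multiplicative notation. -/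
def additiveRels : Set (FreeGroup X) :=
  Set.range fun p : X × X => FreeGroup.of p.1 * FreeGroup.of (S.lam p.1 p.2) *
    (FreeGroup.of (S.lam p.1 p.2) * FreeGroup.of (S.lam (S.lam p.1 p.2) (S.rho p.2 p.1)))⁻¹

/-- The group `⟨X ∣ x + λ_x(y) = λ_x(y) + λ_{λ_x(y)}(ρ_y(x))⟩`, written multiplicatively. It will be
the additive group of the structure skew brace. -/
abbrev DerivedGroup : Type u := PresentedGroup S.additiveRels

/-- The canonical map from `X` to the derived group. -/
def dincl (x : X) : S.DerivedGroup := PresentedGroup.of x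

theorem dincl_mul_dincl (p q : X) :
    S.dincl p * S.dincl q = S.dincl q * S.dincl (S.derived q p) := by
  obtain ⟨y, rfl⟩ := (S.lam p).surjective q
  have h : PresentedGroup.mk S.additiveRels _ = 1 := PresentedGroup.one_of_mem ⟨(p, y), rfl⟩
  rw [map_mul, map_inv, mul_inv_eq_one] at h
  rw [derived_lam]
  exact h

@[elab_as_elim]
theorem derived_induction {p : S.DerivedGroup → Prop} (hof : ∀ x, p (S.dincl x)) (h1 : p 1)
    (hmul : ∀ g h, p g → p h → p (g * h)) (hinv : ∀ g, p g → p g⁻¹) (g : S.DerivedGroup) :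
    p g :=
  PresentedGroup.generated_by _
    { carrier := {g | p g}, mul_mem' := fun {a b} ha hb => hmul a b ha hb, one_mem' := h1,
      inv_mem' := fun {a} ha => hinv a ha } hof g

/-- The homomorphism from the derived group extending a suitable map on `X`. -/
def derivedLift {H : Type v} [Group H] (f : X → H)
    (hf : ∀ p q, f p * f q = f q * f (S.derived q p)) : S.DerivedGroup →* H :=
  PresentedGroup.toGroup (f := f) (by
    rintro _ ⟨⟨x, y⟩, rfl⟩
    simp only [map_mul, map_inv, FreeGroup.lift_apply_of]
    rw [mul_inv_eq_one, hf, derived_lam])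

theorem derivedLift_dincl {H : Type v} [Group H] (f : X → H)
    (hf : ∀ p q, f p * f q = f q * f (S.derived q p)) (x : X) :
    S.derivedLift f hf (S.dincl x) = f x := PresentedGroup.toGroup.of _

/-- The endomorphism of the derived group induced by an element of the structure group. -/
noncomputable def actEnd (g : S.StructureGroup) : S.DerivedGroup →* S.DerivedGroup :=
  S.derivedLift (fun x => S.dincl (S.lamHom g x)) fun p q => by
    rw [lamHom_derived, dincl_mul_dincl]

theorem actEnd_dincl (g : S.StructureGroup) (x : X) :
    S.actEnd g (S.dincl x) = S.dincl (S.lamHom g x) := S.derivedLift_dincl _ _ x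

theorem actEnd_mul (g h : S.StructureGroup) (a : S.DerivedGroup) :
    S.actEnd (g * h) a = S.actEnd g (S.actEnd h a) := by
  refine S.derived_induction ?_ ?_ ?_ ?_ a
  · intro x; simp only [actEnd_dincl, map_mul, Equiv.Perm.mul_apply]
  · simp
  · intro a b ha hb; rw [map_mul, ha, hb, map_mul, map_mul]
  · intro a ha; rw [map_inv, ha, map_inv, map_inv]

theorem actEnd_one (a : S.DerivedGroup) : S.actEnd 1 a = a := by
  refine S.derived_induction ?_ ?_ ?_ ?_ a
  · intro x; simp only [actEnd_dincl, map_one, Equiv.Perm.one_apply]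
  · simp
  · intro a b ha hb; rw [map_mul, ha, hb]
  · intro a ha; rw [map_inv, ha]

/-- The action of the structure group on the derived group by automorphisms. -/
noncomputable def act : S.StructureGroup →* MulAut S.DerivedGroup :=
  MonoidHom.mk'
    (fun g =>
      { toFun := S.actEnd g
        invFun := S.actEnd g⁻¹
        left_inv := fun a => by rw [← actEnd_mul, inv_mul_cancel, actEnd_one]
        right_inv := fun a => by rw [← actEnd_mul, mul_inv_cancel, actEnd_one]
        map_mul' := map_mul _ })
    (fun g h => MulEquiv.ext fun a => S.actEnd_mul g h a)

theorem act_dincl (g : S.StructureGroup) (x : X) :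
    S.act g (S.dincl x) = S.dincl (S.lamHom g x) := S.actEnd_dincl g x

/-- The homomorphism `x ↦ (x, x)` from the structure group to the semidirect product. -/
noncomputable def cocycleHom :
    S.StructureGroup →* SemidirectProduct S.DerivedGroup S.StructureGroup S.act :=
  S.structureLift (fun x => ⟨S.dincl x, S.incl x⟩) fun x y => by
    ext
    · simp only [SemidirectProduct.mul_left, act_dincl, lamHom_incl]
      rw [dincl_mul_dincl, derived_lam]
    · exact S.incl_mul_incl x y

theorem cocycleHom_right (g : S.StructureGroup) : (S.cocycleHom g).right = g := by
  refine S.structure_induction ?_ ?_ ?_ ?_ g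
  · intro x; rw [cocycleHom, structureLift_incl]
  · simp
  · intro a b ha hb; rw [map_mul, SemidirectProduct.mul_right, ha, hb]
  · intro a ha; rw [map_inv, SemidirectProduct.inv_right, ha]

/-- The 1-cocycle from the structure group to the derived group that fixes `X`. -/
noncomputable def cocycle (g : S.StructureGroup) : S.DerivedGroup := (S.cocycleHom g).left

theorem cocycle_incl (x : X) : S.cocycle (S.incl x) = S.dincl x := by
  rw [cocycle, cocycleHom, structureLift_incl]

theorem cocycle_mul (g h : S.StructureGroup) :
    S.cocycle (g * h) = S.cocycle g * S.act g (S.cocycle h) := by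
  rw [cocycle, map_mul, SemidirectProduct.mul_left, cocycleHom_right]; rfl

theorem cocycle_one : S.cocycle 1 = 1 := by rw [cocycle, map_one]; rfl

theorem cocycle_inv (g : S.StructureGroup) : S.cocycle g⁻¹ = S.act g⁻¹ (S.cocycle g)⁻¹ := by
  rw [cocycle, map_inv, SemidirectProduct.inv_left, cocycleHom_right]; rfl

/-- The permutation `g ↦ g λ_g⁻¹(x)` of the structure group (adding `x` on the right). -/
noncomputable def addRight (x : X) : Equiv.Perm S.StructureGroup :=
  Equiv.ofBijective (fun g => g * S.incl ((S.lamHom g)⁻¹ x)) (by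
    let T := Equiv.ofBijective _ S.diag_bijective
    have hT : ∀ y, T.symm ((S.lam y)⁻¹ y) = y := fun y => T.symm_apply_apply y
    have hT' : ∀ y, (S.lam (T.symm y))⁻¹ (T.symm y) = y := fun y => T.apply_symm_apply y
    refine Function.bijective_iff_has_inverse.2
      ⟨fun h => h * (S.incl (T.symm ((S.lamHom h)⁻¹ x)))⁻¹, ?_, ?_⟩
    · intro g
      simp only [map_mul, lamHom_incl, mul_inv_rev, Equiv.Perm.mul_apply, hT]
      rw [mul_inv_cancel_right]
    · intro h
      simp only [map_mul, map_inv, lamHom_incl, mul_inv_rev, Equiv.Perm.mul_apply, inv_inv]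
      have h1 := hT' ((S.lamHom h)⁻¹ x)
      rw [Equiv.Perm.inv_eq_iff_eq] at h1
      rw [← h1, inv_mul_cancel_right])

theorem addRight_apply (x : X) (g : S.StructureGroup) :
    S.addRight x g = g * S.incl ((S.lamHom g)⁻¹ x) := rfl

theorem addRight_comm (p q : X) (g : S.StructureGroup) :
    S.addRight q (S.addRight p g) = S.addRight (S.derived q p) (S.addRight q g) := by
  simp only [addRight_apply, map_mul, mul_inv_rev, Equiv.Perm.mul_apply, lamHom_incl]
  rw [← map_inv, lamHom_derived]
  generalize S.lamHom g⁻¹ p = p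
  generalize S.lamHom g⁻¹ q = q
  rw [mul_assoc, mul_assoc, incl_mul_incl]
  simp [derived]

/-- The action of the derived group on the structure group, `dincl x` acting as the inverse of
`addRight x`. -/
noncomputable def addHom : S.DerivedGroup →* Equiv.Perm S.StructureGroup :=
  S.derivedLift (fun x => (S.addRight x)⁻¹) fun p q => by
    rw [← mul_inv_rev, ← mul_inv_rev]
    congr 1
    ext g
    exact S.addRight_comm p q g

theorem addHom_dincl (x : X) : S.addHom (S.dincl x) = (S.addRight x)⁻¹ :=
  S.derivedLift_dincl _ _ x

theorem cocycle_addHom (a : S.DerivedGroup) :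
    ∀ g, S.cocycle ((S.addHom a)⁻¹ g) = S.cocycle g * a := by
  refine S.derived_induction ?_ ?_ ?_ ?_ a
  · intro x g
    rw [addHom_dincl, inv_inv, addRight_apply, cocycle_mul, cocycle_incl, act_dincl]
    simp
  · intro g; simp
  · intro a b ha hb g
    rw [map_mul, mul_inv_rev, Equiv.Perm.mul_apply, hb, ha, mul_assoc]
  · intro a ha g
    have h := ha (S.addHom a g)
    rw [show (S.addHom a)⁻¹ (S.addHom a g) = g from (S.addHom a).symm_apply_apply g] at h
    rw [map_inv, inv_inv, h, mul_inv_cancel_right]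

theorem addHom_cocycle (g : S.StructureGroup) :
    ∀ k, (S.addHom (S.act k (S.cocycle g)))⁻¹ k = k * g := by
  refine S.structure_induction ?_ ?_ ?_ ?_ g
  · intro x k
    rw [cocycle_incl, act_dincl, addHom_dincl, inv_inv, addRight_apply]
    simp
  · intro k; simp [cocycle_one]
  · intro g h hg hh k
    rw [cocycle_mul, map_mul, map_mul, mul_inv_rev, Equiv.Perm.mul_apply, hg, ← MulAut.mul_apply,
      ← map_mul, hh, mul_assoc]
  · intro g hg k
    have h := hg (k * g⁻¹)
    rw [inv_mul_cancel_right, Equiv.Perm.inv_eq_iff_eq] at h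
    rw [cocycle_inv, ← MulAut.mul_apply, ← map_mul, map_inv, map_inv, inv_inv]
    exact h.symm

theorem cocycle_bijective : Function.Bijective S.cocycle := by
  refine Function.bijective_iff_has_inverse.2 ⟨fun a => (S.addHom a)⁻¹ 1, ?_, ?_⟩
  · intro g
    have h := S.addHom_cocycle g 1
    rwa [map_one S.act, MulAut.one_apply, one_mul] at h
  · intro a
    simp only [cocycle_addHom, cocycle_one, one_mul]

/-- The bijective 1-cocycle, as an equivalence onto the additive group of the structure skew
brace. -/
noncomputable def cocycleEquiv : S.StructureGroup ≃ Additive S.DerivedGroup :=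
  (Equiv.ofBijective _ S.cocycle_bijective).trans Additive.ofMul

/-- The structure skew brace: the structure group, with the sum transported from
`⟨X ∣ x + λ_x(y) = λ_x(y) + λ_{λ_x(y)}(ρ_y(x))⟩` along the bijective 1-cocycle that is the identity
on `X`. -/
noncomputable instance structureSkewBrace : SkewBrace S.StructureGroup where
  toAddGroup := S.cocycleEquiv.addGroup
  toGroup := inferInstance
  mul_add_eq a b c := by
    let _ := S.cocycleEquiv.addGroup
    have hadd : ∀ g h, S.cocycle (g + h) = S.cocycle g * S.cocycle h := fun g h =>
      congrArg Additive.toMul (S.cocycleEquiv.apply_symm_apply _)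
    have hsub : ∀ g h, S.cocycle (g - h) = S.cocycle g * (S.cocycle h)⁻¹ := fun g h =>
      (congrArg Additive.toMul (S.cocycleEquiv.apply_symm_apply
        (S.cocycleEquiv g - S.cocycleEquiv h))).trans (div_eq_mul_inv _ _)
    apply S.cocycle_bijective.1
    change S.cocycle (a * (b + c)) = S.cocycle (a * b - a + a * c)
    rw [cocycle_mul, hadd, hadd, hsub, cocycle_mul, cocycle_mul, map_mul]
    group

theorem cocycle_add (g h : S.StructureGroup) :
    S.cocycle (g + h) = S.cocycle g * S.cocycle h :=
  congrArg Additive.toMul (S.cocycleEquiv.apply_symm_apply _)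

theorem cocycle_lam (g h : S.StructureGroup) :
    S.cocycle (SkewBrace.lam g h) = S.act g (S.cocycle h) := by
  have h1 := S.cocycle_add g (SkewBrace.lam g h)
  rw [SkewBrace.add_lam, cocycle_mul] at h1
  exact (mul_left_cancel h1).symm

/-- The action `λ` of the structure skew brace extends that of the solution. -/
theorem lam_incl (g : S.StructureGroup) (x : X) :
    SkewBrace.lam g (S.incl x) = S.incl (S.lamHom g x) := by
  apply S.cocycle_bijective.1
  rw [cocycle_lam, cocycle_incl, cocycle_incl, act_dincl]

/-- The action `ρ` of the structure skew brace extends that of the solution. -/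
theorem rho_incl (g : S.StructureGroup) : ∀ x : X,
    SkewBrace.rho g (S.incl x) = S.incl ((S.rhoInvHom g)⁻¹ x) := by
  refine S.structure_induction ?_ ?_ ?_ ?_ g
  · intro y x
    rw [SkewBrace.rho, lam_incl, lamHom_incl, rhoInvHom_incl, inv_inv, mul_assoc, incl_mul_incl,
      inv_mul_cancel_left]
  · intro x
    rw [SkewBrace.rho_one, map_one, inv_one, Equiv.Perm.one_apply]
  · intro g h hg hh x
    rw [SkewBrace.rho_mul, hg, hh, map_mul, mul_inv_rev, Equiv.Perm.mul_apply]
  · intro g hg x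
    have h := hg (S.rhoInvHom g x)
    rw [show (S.rhoInvHom g)⁻¹ (S.rhoInvHom g x) = x from
      (S.rhoInvHom g).symm_apply_apply x] at h
    rw [← h, ← SkewBrace.rho_mul, map_inv, inv_inv, mul_inv_cancel]
    rw [SkewBrace.rho_one]

/-! ### The permutation skew brace -/

/-- The permutation group `𝒢(X, r) = ⟨(λ_x, ρ_x⁻¹) ∣ x ∈ X⟩`. -/
def permutationGroup : Subgroup (Equiv.Perm X × Equiv.Perm X) :=
  Subgroup.closure (Set.range fun x => (S.lam x, (S.rho x)⁻¹))

theorem prod_mem (g : S.StructureGroup) :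
    (S.lamHom.prod S.rhoInvHom) g ∈ S.permutationGroup := by
  refine S.structure_induction ?_ ?_ ?_ ?_ g
  · intro x
    refine Subgroup.subset_closure ⟨x, ?_⟩
    rw [MonoidHom.prod_apply, lamHom_incl, rhoInvHom_incl]
  · rw [map_one]; exact one_mem _
  · intro g h hg hh; rw [map_mul]; exact mul_mem hg hh
  · intro g hg; rw [map_inv]; exact inv_mem hg

/-- The homomorphism `h : G(X, r) → 𝒢(X, r)`, `x ↦ (λ_x, ρ_x⁻¹)`. -/
noncomputable def permutationHom : S.StructureGroup →* S.permutationGroup :=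
  (S.lamHom.prod S.rhoInvHom).codRestrict _ S.prod_mem

theorem permutationHom_surjective : Function.Surjective S.permutationHom := by
  have h : S.permutationGroup ≤ (S.lamHom.prod S.rhoInvHom).range := by
    refine (Subgroup.closure_le _).2 ?_
    rintro _ ⟨x, rfl⟩
    exact ⟨S.incl x, by rw [MonoidHom.prod_apply, lamHom_incl, rhoInvHom_incl]⟩
  rintro ⟨p, hp⟩
  obtain ⟨g, hg⟩ := h hp
  exact ⟨g, Subtype.ext hg⟩

theorem permutationHom_eq_one {g : S.StructureGroup} :
    S.permutationHom g = 1 ↔ S.lamHom g = 1 ∧ S.rhoInvHom g = 1 := by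
  rw [← Prod.mk_eq_one, Subtype.ext_iff]; rfl

theorem act_eq_self {g : S.StructureGroup} (hg : S.lamHom g = 1) (a : S.DerivedGroup) :
    S.act g a = a := by
  refine S.derived_induction ?_ ?_ ?_ ?_ a
  · intro x; rw [act_dincl, hg]; rfl
  · simp
  · intro a b ha hb; rw [map_mul, ha, hb]
  · intro a ha; rw [map_inv, ha]

theorem lam_eq_self {g : S.StructureGroup} (hg : S.lamHom g = 1) (h : S.StructureGroup) :
    SkewBrace.lam g h = h := by
  apply S.cocycle_bijective.1
  rw [cocycle_lam, S.act_eq_self hg]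

/-- Elements of the kernel of `h` are central in the additive group. -/
theorem add_comm_of_ker {w : S.StructureGroup} (hw : S.permutationHom w = 1)
    (g : S.StructureGroup) : w + g = g + w := by
  have hx : ∀ w, S.permutationHom w = 1 → ∀ x, S.cocycle w * S.dincl x = S.dincl x * S.cocycle w := by
    intro w hw x
    set w' := (S.incl x)⁻¹ * w * S.incl x with hw'
    have hk : S.permutationHom w' = 1 := by rw [hw', map_mul, map_mul, hw]; simp
    have h1 : SkewBrace.rho w' (S.incl x) = S.incl x := by
      rw [rho_incl, (S.permutationHom_eq_one.1 hk).2]; rfl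
    have h2 := SkewBrace.lam_mul_rho (S.incl x) w'
    have h3 : S.incl x * w' = w * S.incl x := by rw [hw']; group
    rw [h1, h3, mul_left_inj] at h2
    have h4 := SkewBrace.add_lam (S.incl x) w'
    rw [h2, h3] at h4
    have h5 := congrArg S.cocycle h4
    rw [cocycle_add, cocycle_mul, S.act_eq_self (S.permutationHom_eq_one.1 hw).1,
      cocycle_incl] at h5
    exact h5.symm
  apply S.cocycle_bijective.1
  rw [cocycle_add, cocycle_add]
  generalize S.cocycle g = a
  refine S.derived_induction ?_ ?_ ?_ ?_ a
  · exact hx w hw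
  · simp
  · intro a b ha hb; rw [← mul_assoc, ha, mul_assoc, hb, mul_assoc]
  · intro a ha; exact (Commute.inv_right (show Commute _ _ from ha)).eq

/-- The kernel of `h : G(X, r) → 𝒢(X, r)`, an ideal of the structure skew brace. -/
def permutationKer : SkewBrace.SkewIdeal S.StructureGroup where
  carrier := {g | S.permutationHom g = 1}
  add_mem' {a b} ha hb := by
    have h := SkewBrace.add_lam a b
    rw [S.lam_eq_self (S.permutationHom_eq_one.1 ha).1] at h
    change S.permutationHom (a + b) = 1
    rw [h, map_mul, ha, hb, mul_one]
  zero_mem' := by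
    change S.permutationHom 0 = 1
    rw [← SkewBrace.one_eq_zero, map_one]
  neg_mem' {a} ha := by
    have h := SkewBrace.add_lam a a⁻¹
    rw [S.lam_eq_self (S.permutationHom_eq_one.1 ha).1, mul_inv_cancel,
      SkewBrace.one_eq_zero] at h
    change S.permutationHom (-a) = 1
    rw [neg_eq_of_add_eq_zero_right h, map_inv, ha, inv_one]
  lam_mem' a b hb := by
    set b' := a * b * a⁻¹ with hb'
    have hk : S.permutationHom b' = 1 := by
      rw [hb', map_mul, map_mul, show S.permutationHom b = 1 from hb]; simp
    have h1 := SkewBrace.add_lam b' a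
    rw [S.lam_eq_self (S.permutationHom_eq_one.1 hk).1, S.add_comm_of_ker hk] at h1
    have h2 : SkewBrace.lam a b = b' := by
      rw [SkewBrace.lam, neg_add_eq_iff_eq_add, h1, hb']; group
    rw [h2]; exact hk
  add_conj_mem' a b hb := by
    rw [← S.add_comm_of_ker hb, add_sub_cancel_right]; exact hb
  mul_conj_mem' a b hb := by
    change S.permutationHom (a * b * a⁻¹) = 1
    rw [map_mul, map_mul, show S.permutationHom b = 1 from hb]; simp

/-- The permutation skew brace: the permutation group, with the sum for which
`h : G(X, r) → 𝒢(X, r)` is a homomorphism of skew braces. -/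
noncomputable instance permutationSkewBrace : SkewBrace S.permutationGroup :=
  SkewBrace.ofSurjective S.permutationHom S.permutationHom_surjective S.permutationKer
    fun _ => Iff.rfl

theorem permutationHom_add (g h : S.StructureGroup) :
    S.permutationHom (g + h) = S.permutationHom g + S.permutationHom h :=
  SkewBrace.ofSurjective_map_add S.permutationHom S.permutationHom_surjective S.permutationKer
    (fun _ => Iff.rfl) g h

/-! ### Homomorphisms and soluble solutions -/

/-- Homomorphisms of solutions: `(f × f) r = s (f × f)`. -/
def IsHom {Y : Type v} (S : YBESolution X) (T : YBESolution Y) (f : X → Y) : Prop :=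
  ∀ p, Prod.map f f (S.r p) = T.r (Prod.map f f p)

/-- `X₀` is an i-kernel of the map `f` on the solution `(X, r)`: it is an equivalence class of
`ker f`, and `r(X₀, Z) = Z × X₀` and `r(Z, X₀) = X₀ × Z` for every equivalence class `Z`. -/
def IsIKernel {Y : Type v} (S : YBESolution X) (f : X → Y) (X₀ : Set X) : Prop :=
  X₀ ∈ (Setoid.ker f).classes ∧
  ∀ Z ∈ (Setoid.ker f).classes, S.r '' (X₀ ×ˢ Z) = Z ×ˢ X₀ ∧ S.r '' (Z ×ˢ X₀) = X₀ ×ˢ Z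

end YBESolution

/-- The solution `(B, r_B)` associated with a skew brace `B`, `r_B(a, b) = (λ_a(b), ρ_b(a))`. -/
def SkewBrace.toSolution (B : Type u) [SkewBrace B] : YBESolution B where
  r p := (SkewBrace.lam p.1 p.2, SkewBrace.rho p.2 p.1)
  bijective := by
    refine Function.bijective_iff_has_inverse.2
      ⟨fun p => (p.1 * p.2 - p.1, (p.1 * p.2 - p.1)⁻¹ * (p.1 * p.2)), ?_, ?_⟩
    · rintro ⟨a, b⟩
      have h : a * b - SkewBrace.lam a b = a := by
        rw [sub_eq_iff_eq_add, SkewBrace.add_lam]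
      simp [SkewBrace.lam_mul_rho, h]
    · rintro ⟨u, v⟩
      have h : SkewBrace.lam (u * v - u) ((u * v - u)⁻¹ * (u * v)) = u := by
        rw [SkewBrace.lam, mul_inv_cancel_left]; simp
      simp only [SkewBrace.rho, h]
      rw [mul_assoc, mul_inv_cancel_left, inv_mul_cancel_left]
  braid := by
    funext ⟨a, b, c⟩
    simp only [onFirstTwo, onLastTwo, Function.comp_apply, Prod.map, id]
    have h1 : SkewBrace.lam (SkewBrace.lam a b) (SkewBrace.lam (SkewBrace.rho b a) c) =
        SkewBrace.lam a (SkewBrace.lam b c) := by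
      rw [← SkewBrace.mul_lam, SkewBrace.lam_mul_rho, SkewBrace.mul_lam]
    have h3 : SkewBrace.rho c (SkewBrace.rho b a) =
        SkewBrace.rho (SkewBrace.rho c b) (SkewBrace.rho (SkewBrace.lam b c) a) := by
      rw [← SkewBrace.rho_mul, ← SkewBrace.rho_mul, SkewBrace.lam_mul_rho]
    refine Prod.ext h1 (Prod.ext ?_ h3)
    have h5 : SkewBrace.lam (SkewBrace.lam a b) (SkewBrace.lam (SkewBrace.rho b a) c) *
        SkewBrace.rho (SkewBrace.lam (SkewBrace.rho b a) c) (SkewBrace.lam a b) *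
        SkewBrace.rho c (SkewBrace.rho b a) = a * b * c := by
      rw [SkewBrace.lam_mul_rho, mul_assoc, SkewBrace.lam_mul_rho, ← mul_assoc,
        SkewBrace.lam_mul_rho]
    have h6 : SkewBrace.lam a (SkewBrace.lam b c) *
        SkewBrace.lam (SkewBrace.rho (SkewBrace.lam b c) a) (SkewBrace.rho c b) *
        SkewBrace.rho (SkewBrace.rho c b) (SkewBrace.rho (SkewBrace.lam b c) a) = a * b * c := by
      rw [mul_assoc, SkewBrace.lam_mul_rho, ← mul_assoc, SkewBrace.lam_mul_rho, mul_assoc,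
        SkewBrace.lam_mul_rho, mul_assoc]
    rw [← h6, h1, h3, mul_left_inj, mul_right_inj] at h5
    exact h5
  lam_bijective a := Function.bijective_iff_has_inverse.2
    ⟨SkewBrace.lam a⁻¹, SkewBrace.lam_inv_lam a, SkewBrace.lam_lam_inv a⟩
  rho_bijective b := by
    refine Function.bijective_iff_has_inverse.2 ⟨SkewBrace.rho b⁻¹, ?_, ?_⟩
    · intro a
      simp only
      rw [← SkewBrace.rho_mul, mul_inv_cancel, SkewBrace.rho_one]
    · intro a
      simp only
      rw [← SkewBrace.rho_mul, inv_mul_cancel, SkewBrace.rho_one]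

/-- A solution `(X, r)` is soluble if there are skew braces `C 0, ..., C t`, i-epimorphisms of
solutions `f k : X → C k` with i-kernels `X' k` for `k < t`, and an epimorphism of solutions
`f t : X → C t`, such that `ker (f 0)` has the single class `X`, `ker (f t) ⊆ ker ι`, and for all
`k < t`: `ker (f (k + 1)) ⊆ ker (f k)`, and `f (k + 1)` maps `X' k` into an abelian ideal `J` of
`C (k + 1)` such that `f (k + 1) x` and `f (k + 1) y` have the same coset modulo `J` whenever
`f k x = f k y`. (The data with index greater than `t` are irrelevant.) -/
def YBESolution.IsSoluble {X : Type u} (S : YBESolution X) : Prop :=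
  ∃ (t : ℕ) (C : ℕ → Type u) (_ : ∀ k, SkewBrace (C k)) (f : ∀ k, X → C k) (X' : ℕ → Set X),
    (∀ k ≤ t, S.IsHom (SkewBrace.toSolution (C k)) (f k) ∧ Function.Surjective (f k)) ∧
    (∀ k < t, S.IsIKernel (f k) (X' k)) ∧
    Setoid.ker (f 0) = ⊤ ∧
    Setoid.ker (f t) ≤ Setoid.ker S.incl ∧
    ∀ k < t,
      Setoid.ker (f (k + 1)) ≤ Setoid.ker (f k) ∧
      ∃ J : SkewBrace.SkewIdeal (C (k + 1)),
        SkewBrace.IsAbelianSet (J : Set (C (k + 1))) ∧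
        f (k + 1) '' X' k ⊆ J ∧
        ∀ x y, f k x = f k y → J.proj (f (k + 1) x) = J.proj (f (k + 1) y)

/-! Everything reduces to two permanence properties: solubility of skew braces passes to homomorphic
images (`isSoluble_of_surjective`) and to extensions with abelian kernel (`isSoluble_of_ker`).

For any solution `X`, the kernel of `G_X → 𝒢(X, r)` acts trivially under `λ` and is central in the
additive group, hence is abelian; so `G_X` and `𝒢(X, r)` are soluble together. A homomorphism `f`
from `X` to the solution of a skew brace `D` induces a homomorphism of skew braces `G_X → D`, and
when `f` is injective its kernel lies in that of `G_X → 𝒢(X, r)`. Applied to the identity of `B`,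
this gives a surjection `G_B → B` with abelian kernel, so `G_B` and `B` are soluble together.

If `B` is soluble, the projections `B → B / I_k` witness solubility of the associated solution, the
ideals `I_k` being the i-kernels. For the converse, an epimorphism of associated solutions `B → D`
need not be a homomorphism of skew braces, but it yields a surjective one `G_B → D`, so solubility
still passes from `B` to `D` (`IsSoluble.of_isHom`). In a chain witnessing solubility of the
solution, `C (k + 1) / J` is such an image of `C k` and `J` is abelian, so every `C k` is soluble by
induction. Finally `ι` is injective on `B`, so `f t` is an isomorphism of solutions, and solubility
is carried back from `C t` to `B`. -/

namespace SkewBrace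

/-! ### Preliminary identities and the zero ideal. -/

/-- This is the matched pair identity `lam_mul` applied to `b * b⁻¹ = 1`. It handles inverses in the
induction of `IsHom.structureMap_lam`. -/
theorem lam_rho_inv {B : Type u} [SkewBrace B] (a b : B) :
    lam (rho b a) b⁻¹ = (lam a b)⁻¹ := by
  rw [eq_inv_iff_mul_eq_one, mul_eq_one_iff_eq_inv', eq_inv_iff_mul_eq_one, ← lam_mul,
    mul_inv_cancel, one_eq_zero, lam_zero]

/-- Expressing abelian factors by membership in `I` removes the quotients, so that the condition can
be carried along images and preimages of ideals. -/
theorem isAbelianSet_proj_iff {B : Type u} [SkewBrace B] (I : SkewIdeal B) (S : Set B) :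
    IsAbelianSet (I.proj '' S) ↔
      ∀ a ∈ S, ∀ b ∈ S, (a + b)⁻¹ * (a * b) ∈ I ∧ (a + b)⁻¹ * (b + a) ∈ I := by
  simp only [IsAbelianSet, Set.forall_mem_image, ← I.proj_add, ← I.proj_mul, I.proj_eq_proj]

/-- The zero ideal. -/
def SkewIdeal.zero (B : Type u) [SkewBrace B] : SkewIdeal B where
  toAddSubgroup := ⊥
  lam_mem' a b hb := by
    obtain rfl : b = 0 := hb
    exact lam_zero a
  add_conj_mem' a b hb := by
    obtain rfl : b = 0 := hb
    change a + 0 - a = 0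
    simp
  mul_conj_mem' a b hb := by
    obtain rfl : b = 0 := hb
    change a * 0 * a⁻¹ = 0
    rw [mul_zero_eq, mul_inv_cancel, one_eq_zero]

/-! ### Homomorphisms of skew braces and permanence of solubility. -/

/-- A homomorphism of skew braces, as a homomorphism of the multiplicative groups that preserves
sums. -/
structure IsBraceHom {A : Type u} {D : Type v} [SkewBrace A] [SkewBrace D] (φ : A →* D) :
    Prop where
  map_add : ∀ a b, φ (a + b) = φ a + φ b

namespace IsBraceHom

variable {A : Type u} {D : Type v} [SkewBrace A] [SkewBrace D] {φ : A →* D}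

theorem map_zero (_ : IsBraceHom φ) : φ 0 = 0 := by
  rw [← one_eq_zero, map_one, one_eq_zero]

theorem map_neg (h : IsBraceHom φ) (a : A) : φ (-a) = -φ a := by
  rw [eq_neg_iff_add_eq_zero, ← h.map_add, neg_add_cancel, h.map_zero]

theorem map_lam (h : IsBraceHom φ) (a b : A) : φ (lam a b) = lam (φ a) (φ b) := by
  rw [lam, lam, h.map_add, h.map_neg, map_mul]

theorem map_rho (h : IsBraceHom φ) (a b : A) : φ (rho a b) = rho (φ a) (φ b) := by
  rw [rho, rho, map_mul, map_mul, map_inv, h.map_lam]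

/-- The sum is determined by the product and `λ`, through `a + b = a λ_a⁻¹(b)`. -/
theorem of_map_lam (h : ∀ a b, φ (lam a b) = lam (φ a) (φ b)) : IsBraceHom φ where
  map_add a b := by
    have e : a + b = a * lam a⁻¹ b := by rw [← add_lam, lam_lam_inv]
    rw [e, map_mul, h, map_inv, ← add_lam, lam_lam_inv]

/-- The image of an ideal under a surjective homomorphism. -/
def map (h : IsBraceHom φ) (hs : Function.Surjective φ) (I : SkewIdeal A) : SkewIdeal D where
  carrier := φ '' I
  add_mem' := by
    rintro _ _ ⟨a, ha, rfl⟩ ⟨b, hb, rfl⟩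
    exact ⟨a + b, I.add_mem ha hb, h.map_add a b⟩
  zero_mem' := ⟨0, I.zero_mem, h.map_zero⟩
  neg_mem' := by
    rintro _ ⟨a, ha, rfl⟩
    exact ⟨-a, I.neg_mem ha, h.map_neg a⟩
  lam_mem' := by
    rintro x _ ⟨b, hb, rfl⟩
    obtain ⟨a, rfl⟩ := hs x
    exact ⟨lam a b, I.lam_mem a hb, h.map_lam a b⟩
  add_conj_mem' := by
    rintro x _ ⟨b, hb, rfl⟩
    obtain ⟨a, rfl⟩ := hs x
    refine ⟨a + b - a, I.add_conj_mem' a b hb, ?_⟩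
    rw [sub_eq_add_neg, h.map_add, h.map_add, h.map_neg, ← sub_eq_add_neg]
  mul_conj_mem' := by
    rintro x _ ⟨b, hb, rfl⟩
    obtain ⟨a, rfl⟩ := hs x
    exact ⟨a * b * a⁻¹, I.mul_conj_mem' a b hb, by simp⟩

/-- The preimage of an ideal under a homomorphism. -/
def comap (h : IsBraceHom φ) (I : SkewIdeal D) : SkewIdeal A where
  carrier := φ ⁻¹' I
  add_mem' {a b} ha hb := by
    rw [Set.mem_preimage, h.map_add]
    exact I.add_mem ha hb
  zero_mem' := by
    rw [Set.mem_preimage, h.map_zero]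
    exact I.zero_mem
  neg_mem' {a} ha := by
    rw [Set.mem_preimage, h.map_neg]
    exact I.neg_mem ha
  lam_mem' a b hb := by
    rw [Set.mem_preimage, h.map_lam]
    exact I.lam_mem _ hb
  add_conj_mem' a b hb := by
    rw [Set.mem_preimage, sub_eq_add_neg, h.map_add, h.map_add, h.map_neg, ← sub_eq_add_neg]
    exact I.add_conj_mem' _ _ hb
  mul_conj_mem' a b hb := by
    rw [Set.mem_preimage, map_mul, map_mul, map_inv]
    exact I.mul_conj_mem' _ _ hb

theorem mem_comap (h : IsBraceHom φ) {I : SkewIdeal D} {a : A} : a ∈ h.comap I ↔ φ a ∈ I :=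
  Iff.rfl

/-- A homomorphic image of a soluble skew brace is soluble. -/
theorem isSoluble_of_surjective (h : IsBraceHom φ) (hs : Function.Surjective φ)
    (hA : IsSoluble A) : IsSoluble D := by
  obtain ⟨t, I, h0, ht, hI⟩ := hA
  refine ⟨t, fun k => h.map hs (I k), ?_, ?_, fun k hk => ?_⟩
  · change φ '' I 0 = Set.univ
    rw [h0, Set.image_univ, hs.range_eq]
  · change φ '' I t = {0}
    rw [ht, Set.image_singleton, h.map_zero]
  · refine ⟨Set.image_mono (hI k hk).1, ?_⟩
    have h2 := (isAbelianSet_proj_iff _ _).1 (hI k hk).2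
    rw [isAbelianSet_proj_iff]
    rintro _ ⟨a, ha, rfl⟩ _ ⟨b, hb, rfl⟩
    exact ⟨⟨_, (h2 a ha b hb).1, by simp [h.map_add]⟩, ⟨_, (h2 a ha b hb).2, by simp [h.map_add]⟩⟩

/-- A skew brace that maps to a soluble skew brace with abelian kernel is soluble. -/
theorem isSoluble_of_ker (h : IsBraceHom φ) (hk : IsAbelianSet {a | φ a = 0})
    (hD : IsSoluble D) : IsSoluble A := by
  obtain ⟨t, I, h0, ht, hI⟩ := hD
  -- The pulled back chain ends at the kernel of `φ`, so the zero ideal is appended as one further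
  -- term.
  refine ⟨t + 1, fun k => if k ≤ t then h.comap (I k) else SkewIdeal.zero A, ?_, ?_,
    fun k hk' => ?_⟩
  · simp only [zero_le, if_true]
    change φ ⁻¹' I 0 = Set.univ
    rw [h0, Set.preimage_univ]
  · simp only [Nat.not_succ_le_self, if_false]
    rfl
  · rw [isAbelianSet_proj_iff]
    rcases Nat.lt_succ_iff_lt_or_eq.1 hk' with hlt | rfl
    · simp only [hlt.le, Nat.succ_le_of_lt hlt, if_true]
      refine ⟨fun a ha => (hI k hlt).1 ha, fun a ha b hb => ?_⟩
      have h2 := (isAbelianSet_proj_iff _ _).1 (hI k hlt).2 (φ a) ha (φ b) hb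
      simpa [h.mem_comap, h.map_add] using h2
    · simp only [le_refl, Nat.not_succ_le_self, if_true, if_false]
      refine ⟨?_, fun a ha b hb => ?_⟩
      · rintro a (rfl : a = 0)
        exact SkewIdeal.zero_mem _
      -- This is the new bottom factor: the last ideal of the given chain is zero, so its preimage
      -- is the kernel, abelian by `hk`.
      · have hmem : ∀ {a}, φ a ∈ (I k : Set D) → φ a = 0 := fun {a} ha => by rwa [ht] at ha
        obtain ⟨h1, h2⟩ := hk a (hmem ha) b (hmem hb)
        rw [← h2, ← h1, inv_mul_cancel, one_eq_zero]
        exact ⟨SkewIdeal.zero_mem _, SkewIdeal.zero_mem _⟩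

end IsBraceHom

/-! ### Quotients and extensions by abelian ideals. -/

namespace SkewIdeal

variable {B : Type u} [SkewBrace B] (I : SkewIdeal B)

/-- The canonical map `B → B / I` as a homomorphism of the multiplicative groups. -/
noncomputable def projHom : B →* I.Quotient := MonoidHom.mk' I.proj I.proj_mul

theorem isBraceHom_projHom : IsBraceHom I.projHom := ⟨I.proj_add⟩

theorem proj_eq_zero {a : B} : I.proj a = 0 ↔ a ∈ I := by
  have h : I.proj 0 = 0 := I.isBraceHom_projHom.map_zero
  rw [eq_comm, ← h, I.proj_eq_proj, ← one_eq_zero, inv_one, one_mul]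

end SkewIdeal

theorem IsSoluble.of_subsingleton (B : Type u) [SkewBrace B] [Subsingleton B] : IsSoluble B :=
  ⟨0, fun _ => SkewIdeal.zero B, Set.eq_univ_of_forall fun a => Subsingleton.elim a 0, rfl,
    fun _ h => absurd h (Nat.not_lt_zero _)⟩

/-- An extension of a soluble skew brace by an abelian ideal is soluble. -/
theorem IsSoluble.of_quotient {B : Type u} [SkewBrace B] (I : SkewIdeal B)
    (hI : IsAbelianSet (I : Set B)) (h : IsSoluble I.Quotient) : IsSoluble B :=
  I.isBraceHom_projHom.isSoluble_of_ker
    (fun a ha b hb => hI a (I.proj_eq_zero.1 ha) b (I.proj_eq_zero.1 hb)) h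

theorem IsBraceHom.isHom {A : Type u} {D : Type v} [SkewBrace A] [SkewBrace D] {φ : A →* D}
    (h : IsBraceHom φ) : (toSolution A).IsHom (toSolution D) φ :=
  fun p => Prod.ext (h.map_lam p.1 p.2) (h.map_rho p.2 p.1)

end SkewBrace

/-! ### Homomorphisms of solutions and the induced maps on structure skew braces. -/

namespace YBESolution

open SkewBrace

section Comp

variable {X : Type*} {Y : Type*} {Z : Type*} {S : YBESolution X} {T : YBESolution Y}
  {U : YBESolution Z} {f : X → Y} {g : Y → Z}

theorem IsHom.comp (hg : T.IsHom U g) (hf : S.IsHom T f) : S.IsHom U (g ∘ f) := fun p => by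
  rw [← Prod.map_comp_map, Function.comp_apply, hf, hg, Function.comp_apply]

theorem IsHom.of_comp (hf : S.IsHom T f) (hs : Function.Surjective f)
    (hgf : S.IsHom U (g ∘ f)) : T.IsHom U g := fun p => by
  obtain ⟨q, rfl⟩ := hs.prodMap hs p
  have h := hgf q
  rwa [← Prod.map_comp_map, Function.comp_apply, hf, Function.comp_apply] at h

end Comp

section StructureMap

variable {X : Type u} {S : YBESolution X} {D : Type v} [SkewBrace D] {f : X → D}

theorem IsHom.map_lam (hf : S.IsHom (toSolution D) f) (x y : X) :
    f (S.lam x y) = SkewBrace.lam (f x) (f y) := congrArg Prod.fst (hf (x, y))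

theorem IsHom.map_rho (hf : S.IsHom (toSolution D) f) (x y : X) :
    f (S.rho x y) = SkewBrace.rho (f x) (f y) := congrArg Prod.snd (hf (y, x))

/-- The homomorphism from the structure skew brace of a solution to a skew brace `D` induced by a
homomorphism to the solution associated with `D`. -/
noncomputable def IsHom.structureMap (hf : S.IsHom (toSolution D) f) : S.StructureGroup →* D :=
  S.structureLift f fun x y => by rw [hf.map_lam, hf.map_rho, lam_mul_rho]

variable (hf : S.IsHom (toSolution D) f)

theorem IsHom.structureMap_incl (x : X) : hf.structureMap (S.incl x) = f x :=
  S.structureLift_incl _ _ x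

theorem IsHom.map_lamHom (g : S.StructureGroup) :
    ∀ x, f (S.lamHom g x) = SkewBrace.lam (hf.structureMap g) (f x) := by
  refine S.structure_induction ?_ ?_ ?_ ?_ g
  · intro y x
    rw [lamHom_incl, hf.map_lam, hf.structureMap_incl]
  · intro x
    rw [map_one, map_one, one_lam, Equiv.Perm.one_apply]
  · intro g h hg hh x
    rw [map_mul, map_mul, mul_lam, Equiv.Perm.mul_apply, hg, hh]
  · intro g hg x
    have h := hg (S.lamHom g⁻¹ x)
    rw [← Equiv.Perm.mul_apply, ← map_mul, mul_inv_cancel, map_one, Equiv.Perm.one_apply] at h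
    rw [h, map_inv hf.structureMap, lam_inv_lam]

/-- The map is defined multiplicatively, so compatibility with `λ` is what makes it additive. The
induction runs on the argument `h`, uniformly in `g`, because expanding `λ_g` of a product changes
the acting element to `ρ_a(g)`. -/
theorem IsHom.structureMap_lam (h : S.StructureGroup) :
    ∀ g, hf.structureMap (SkewBrace.lam g h) =
      SkewBrace.lam (hf.structureMap g) (hf.structureMap h) := by
  -- Since `ρ_h(g) = λ_g(h)⁻¹ g h`, compatibility with `λ` at a pair gives compatibility with `ρ` at
  -- the same pair.
  have hrho : ∀ g h, hf.structureMap (SkewBrace.lam g h) =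
      SkewBrace.lam (hf.structureMap g) (hf.structureMap h) →
      hf.structureMap (SkewBrace.rho h g) =
      SkewBrace.rho (hf.structureMap h) (hf.structureMap g) := by
    intro g h e
    rw [SkewBrace.rho, SkewBrace.rho, map_mul, map_mul, map_inv, e]
  refine S.structure_induction ?_ ?_ ?_ ?_ h
  · intro x g
    rw [lam_incl, hf.structureMap_incl, hf.structureMap_incl, hf.map_lamHom]
  · intro g
    rw [map_one, one_eq_zero, lam_zero, ← one_eq_zero, map_one, one_eq_zero, lam_zero]
  · intro a b ha hb g
    rw [lam_mul, map_mul, map_mul, lam_mul, ha, hb, hrho _ _ (ha g)]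
  · intro a ha g
    -- As `ρ_a` is surjective, the acting element may be taken of the form `ρ_a(k)`, the form
    -- required by `lam_rho_inv`.
    obtain ⟨k, rfl⟩ : ∃ k, SkewBrace.rho a k = g :=
      ⟨SkewBrace.rho a⁻¹ g, by rw [← rho_mul, inv_mul_cancel, rho_one]⟩
    rw [lam_rho_inv, map_inv, map_inv, hrho _ _ (ha k), lam_rho_inv, ha]

theorem IsHom.isBraceHom_structureMap : IsBraceHom hf.structureMap :=
  .of_map_lam fun a b => hf.structureMap_lam b a

theorem IsHom.structureMap_surjective (hs : Function.Surjective f) :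
    Function.Surjective hf.structureMap := fun d => by
  obtain ⟨x, rfl⟩ := hs d
  exact ⟨S.incl x, hf.structureMap_incl x⟩

/-- If `f` is injective, the kernel of the induced map is contained in that of `G_X → 𝒢(X, r)`. -/
theorem IsHom.permutationHom_eq_one (hi : Function.Injective f) {g : S.StructureGroup}
    (hg : hf.structureMap g = 0) : S.permutationHom g = 1 := by
  rw [← one_eq_zero] at hg
  rw [S.permutationHom_eq_one]
  constructor
  · ext x
    apply hi
    rw [hf.map_lamHom, hg, one_lam, Equiv.Perm.one_apply]
  · rw [← inv_eq_one]
    ext x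
    apply hi
    -- The right action of `g` on `X` is read inside `G_X`, where it is `ρ_g` on the generators; the
    -- induced map sends it to `ρ` of the identity.
    rw [← hf.structureMap_incl, ← rho_incl, hf.isBraceHom_structureMap.map_rho, hg, rho_one,
      hf.structureMap_incl, Equiv.Perm.one_apply]

end StructureMap

/-! ### The structure skew brace against the permutation skew brace. -/

variable {X : Type u} (S : YBESolution X)

theorem isBraceHom_permutationHom : IsBraceHom S.permutationHom := ⟨S.permutationHom_add⟩

theorem isAbelianSet_permutationKer : IsAbelianSet {g | S.permutationHom g = 1} := by
  intro a ha b hb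
  refine ⟨?_, S.add_comm_of_ker ha b⟩
  rw [← add_lam a b, S.lam_eq_self (S.permutationHom_eq_one.1 ha).1]

theorem isSoluble_structureGroup_iff :
    SkewBrace.IsSoluble S.StructureGroup ↔ SkewBrace.IsSoluble S.permutationGroup := by
  refine ⟨S.isBraceHom_permutationHom.isSoluble_of_surjective S.permutationHom_surjective,
    S.isBraceHom_permutationHom.isSoluble_of_ker ?_⟩
  rw [← one_eq_zero]
  exact S.isAbelianSet_permutationKer

theorem isHom_id (B : Type u) [SkewBrace B] : (toSolution B).IsHom (toSolution B) id :=
  fun _ => rfl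

end YBESolution

/-! ### Solubility of a skew brace against that of its associated solution. -/

namespace SkewBrace

open YBESolution

theorem isSoluble_structureGroup_toSolution_iff (B : Type u) [SkewBrace B] :
    IsSoluble (toSolution B).StructureGroup ↔ IsSoluble B := by
  have hf := isHom_id B
  refine ⟨hf.isBraceHom_structureMap.isSoluble_of_surjective
      (hf.structureMap_surjective Function.surjective_id),
    hf.isBraceHom_structureMap.isSoluble_of_ker fun a ha b hb => ?_⟩
  exact isAbelianSet_permutationKer _ a (hf.permutationHom_eq_one Function.injective_id ha) b
    (hf.permutationHom_eq_one Function.injective_id hb)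

/-- If the solution associated with `D` is an epimorphic image of the one associated with a soluble
skew brace, then `D` is soluble. -/
theorem IsSoluble.of_isHom {B : Type u} {D : Type v} [SkewBrace B] [SkewBrace D] {f : B → D}
    (hB : IsSoluble B) (hf : (toSolution B).IsHom (toSolution D) f)
    (hs : Function.Surjective f) : IsSoluble D :=
  hf.isBraceHom_structureMap.isSoluble_of_surjective (hf.structureMap_surjective hs)
    ((isSoluble_structureGroup_toSolution_iff B).2 hB)

/-- An ideal is an i-kernel of the canonical map to the quotient. -/
theorem SkewIdeal.isIKernel_proj {B : Type u} [SkewBrace B] (I : SkewIdeal B) :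
    (toSolution B).IsIKernel I.proj I := by
  -- The classes are the fibres of `I.proj`, with `I` the fibre over `0`. As `r` is bijective
  -- upstairs and downstairs, both i-kernel conditions reduce to `r (0, z) = (z, 0)` and `r (z, 0) =
  -- (0, z)` in the quotient.
  have hI : ∀ x, x ∈ (I : Set B) ↔ I.proj x = 0 := fun x => I.proj_eq_zero.symm
  have hhom := I.isBraceHom_projHom.isHom
  have h0 : ∀ z : I.Quotient, (toSolution I.Quotient).r (0, z) = (z, 0) := fun z => by
    refine Prod.ext ?_ ?_
    · change lam 0 z = z
      rw [← one_eq_zero, one_lam]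
    · change rho z 0 = 0
      rw [rho, ← one_eq_zero, one_lam, mul_one, inv_mul_cancel]
  have h0' : ∀ z : I.Quotient, (toSolution I.Quotient).r (z, 0) = (0, z) := fun z => by
    refine Prod.ext (lam_zero z) ?_
    change rho 0 z = z
    rw [← one_eq_zero, rho_one]
  refine ⟨⟨0, Set.ext fun x => ?_⟩, ?_⟩
  · rw [hI, ← I.isBraceHom_projHom.map_zero]
    rfl
  rintro _ ⟨z, rfl⟩
  have hZ : ∀ x, x ∈ {x | Setoid.ker I.proj x z} ↔ I.proj x = I.proj z := fun _ => Iff.rfl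
  constructor
  · ext q
    obtain ⟨p, rfl⟩ := (toSolution B).bijective.2 q
    have hp := hhom p
    rw [(toSolution B).bijective.1.mem_set_image, Set.mem_prod, Set.mem_prod, hI, hI, hZ, hZ,
      ← Prod.mk_inj, ← Prod.mk_inj, ← h0, ← (toSolution I.Quotient).bijective.1.eq_iff]
    exact Eq.congr hp.symm rfl
  · ext q
    obtain ⟨p, rfl⟩ := (toSolution B).bijective.2 q
    have hp := hhom p
    rw [(toSolution B).bijective.1.mem_set_image, Set.mem_prod, Set.mem_prod, hI, hI, hZ, hZ,
      ← Prod.mk_inj, ← Prod.mk_inj, ← h0', ← (toSolution I.Quotient).bijective.1.eq_iff]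
    exact Eq.congr hp.symm rfl

theorem IsSoluble.toSolution {B : Type u} [SkewBrace B] (hB : IsSoluble B) :
    (toSolution B).IsSoluble := by
  obtain ⟨t, I, h0, ht, hI⟩ := hB
  have mem0 : ∀ x, x ∈ I 0 := fun x => by
    rw [← SetLike.mem_coe, h0]
    trivial
  refine ⟨t, fun k => (I k).Quotient, fun _ => inferInstance, fun k => (I k).proj, fun k => I k,
    fun k _ => ⟨(I k).isBraceHom_projHom.isHom, (I k).proj_surjective⟩,
    fun k _ => (I k).isIKernel_proj, ?_, ?_, fun k hk => ⟨?_, ?_⟩⟩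
  · exact eq_top_iff.2 fun x y _ => (I 0).proj_eq_proj.2 (mem0 _)
  · intro x y h
    have h1 : x⁻¹ * y ∈ (I t : Set B) := (I t).proj_eq_proj.1 h
    rw [ht, Set.mem_singleton_iff, ← one_eq_zero, inv_mul_eq_one] at h1
    exact congrArg _ h1
  · intro x y h
    exact (I k).proj_eq_proj.2 ((hI k hk).1 ((I (k + 1)).proj_eq_proj.1 h))
  · have hh := (I (k + 1)).isBraceHom_projHom
    -- The abelian ideal required is `I k / I (k + 1)`, exactly the image of the i-kernel `I k`.
    refine ⟨hh.map (I (k + 1)).proj_surjective (I k), (hI k hk).2, subset_rfl, fun x y h => ?_⟩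
    rw [SkewIdeal.proj_eq_proj]
    exact ⟨x⁻¹ * y, (I k).proj_eq_proj.1 h, by simp; rfl⟩

/-- Only the epimorphisms, their kernels and the coset condition on `J` enter; the i-kernels play no
role in this direction. -/
theorem IsSoluble.of_toSolution {B : Type u} [SkewBrace B]
    (h : (SkewBrace.toSolution B).IsSoluble) : IsSoluble B := by
  obtain ⟨t, C, _, f, _, hf, -, h0, ht, hJ⟩ := h
  have hC : ∀ k ≤ t, IsSoluble (C k) := by
    intro k
    induction k with
    | zero =>
      intro h
      have : Subsingleton (C 0) := ⟨fun a b => by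
        obtain ⟨x, rfl⟩ := (hf 0 h).2 a
        obtain ⟨y, rfl⟩ := (hf 0 h).2 b
        exact (h0 ▸ trivial : Setoid.ker (f 0) x y)⟩
      exact .of_subsingleton _
    | succ k ih =>
      intro hk
      obtain ⟨-, J, hab, -, hcos⟩ := hJ k hk
      obtain ⟨hom, hs⟩ := hf k (Nat.le_of_succ_le hk)
      obtain ⟨hom', hs'⟩ := hf (k + 1) hk
      refine .of_quotient J hab ?_
      -- The coset condition says that `f (k + 1)` modulo `J` is constant on the fibres of `f k`,
      -- hence factors through `C k`; `g` is this factor map.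
      let g : C k → J.Quotient := fun c => J.proj (f (k + 1) (Function.surjInv hs c))
      have hg : ∀ x, g (f k x) = J.proj (f (k + 1) x) := fun x =>
        hcos _ _ (Function.surjInv_eq hs _)
      have hgf : g ∘ f k = J.projHom ∘ f (k + 1) := funext hg
      refine (ih (Nat.le_of_succ_le hk)).of_isHom (f := g) (hom.of_comp hs ?_) fun d => ?_
      · rw [hgf]
        exact J.isBraceHom_projHom.isHom.comp hom'
      · obtain ⟨c, rfl⟩ := J.proj_surjective d
        obtain ⟨x, rfl⟩ := hs' c
        exact ⟨f k x, hg x⟩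
  obtain ⟨hom, hs⟩ := hf t le_rfl
  -- The map `G_B → B` induced by the identity is a left inverse of `ι`, so `ker ι`, and with it
  -- `ker (f t)`, is trivial.
  have hinj : Function.Injective (f t) := fun x y h => by
    have h1 := congrArg (isHom_id B).structureMap (ht h)
    rwa [IsHom.structureMap_incl, IsHom.structureMap_incl] at h1
  let e := Equiv.ofBijective (f t) ⟨hinj, hs⟩
  have he : e.symm ∘ f t = id := funext e.symm_apply_apply
  refine (hC t le_rfl).of_isHom (f := e.symm) (hom.of_comp hs ?_) e.symm.surjective
  rw [he]
  exact isHom_id B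

end SkewBrace

theorem mainTheorem2 {B : Type u} [SkewBrace B] :
    List.TFAE [SkewBrace.IsSoluble B,
      (SkewBrace.toSolution B).IsSoluble,
      SkewBrace.IsSoluble (SkewBrace.toSolution B).StructureGroup,
      SkewBrace.IsSoluble (SkewBrace.toSolution B).permutationGroup] := by
  tfae_have 1 → 2 := SkewBrace.IsSoluble.toSolution
  tfae_have 2 → 1 := SkewBrace.IsSoluble.of_toSolution
  tfae_have 3 ↔ 1 := SkewBrace.isSoluble_structureGroup_toSolution_iff B
  tfae_have 3 ↔ 4 := (SkewBrace.toSolution B).isSoluble_structureGroup_iff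
  tfae_finish
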